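/- Let $m\ge 1$ and let $\mathbb K$ be $\mathbb R$ or $\mathbb C$. For $N\ge 0$ let $\mathcal H_N$ be the space of $\mathbb K$-valued spherical harmonics of degree $N$ on the unit sphere $S^m\subset\mathbb R^{m+1}$, that is, the restrictions to $S^m$ of the harmonic homogeneous polynomials of degree $N$ on $\mathbb R^{m+1}$ with coefficients in $\mathbb K$, with the inner product of $L^2(S^m)$ with respect to the surface measure. Let $S\mathcal H_N=\{\psi\in\mathcal H_N:\|\psi\|_{L^2}=1\}$ be its unit sphere, and let $\nu_N$ be the uniform (rotation invariant) probability measure on $S\mathcal H_N$. Let $\nu=\prod_{N\ge1}\nu_N$ be the product measure on $\prod_{N\ge 1}S\mathcal H_N$, that is, the law of a sequence of independent random spherical harmonics $\psi_N$ with laws $\nu_N$. 1. There is a constant $C>0$ such that, as $N\to\infty$, $$\nu_N\Big\{\psi\in S\mathcal H_N:\ \sup_{S^m}|\psi|>C\sqrt{\log N}\Big\}=O(N^{-2}),$$ and, with the same $C$, $\displaystyle\limsup_{N\to\infty}\frac{\sup_{S^m}|\psi_N|}{\sqrt{\log N}}\le C$ for $\nu$-almost every sequence $(\psi_N)_{N\ge1}$.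 2. For every real $k>0$ there is $C_0>0$ such that, for every $C\ge C_0$, as $N\to\infty$, $$\nu_N\Big\{\psi\in S\mathcal H_N:\ \sup_{S^m}|\psi|>C\sqrt{\log N}\Big\}=O(N^{-k}).$$ 3. For $\nu$-almost every sequence $(\psi_N)_{N\ge1}$, $\|\psi_N\|_{\infty}=O(\sqrt{\log N})$ as $N\to\infty$. -/

import Mathlib

open MeasureTheory Filter Asymptotics
open scoped ComplexConjugate

/-- The unit sphere `S^m` in `ℝ^(m+1)`. -/
abbrev UnitSphere (m : ℕ) : Type := Metric.sphere (0 : EuclideanSpace ℝ (Fin (m + 1))) 1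

/-- The Riemannian (surface) measure of the round sphere `S^m`. -/
noncomputable def surfaceMeasure (m : ℕ) : Measure (UnitSphere m) :=
  (volume : Measure (EuclideanSpace ℝ (Fin (m + 1)))).toSphere

instance (m : ℕ) : IsFiniteMeasure (surfaceMeasure m) := by
  unfold surfaceMeasure; infer_instance

instance (m : ℕ) : (surfaceMeasure m).IsOpenPosMeasure := by
  unfold surfaceMeasure; infer_instance

/-- The Euclidean Laplacian `∑ i, ∂²P/∂xᵢ²` of a polynomial. -/
noncomputable def polyLaplacian {R σ : Type*} [CommSemiring R] [Fintype σ]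
    (P : MvPolynomial σ R) : MvPolynomial σ R :=
  ∑ i, MvPolynomial.pderiv i (MvPolynomial.pderiv i P)

section SphericalHarmonics

variable (𝕜 : Type*) [RCLike 𝕜]

/-- The restriction to `S^m` of a polynomial on `ℝ^(m+1)` with coefficients in `𝕜`. -/
noncomputable def restrictToSphere (m : ℕ) (P : MvPolynomial (Fin (m + 1)) 𝕜) :
    C(UnitSphere m, 𝕜) where
  toFun x := MvPolynomial.eval (fun i => ((x : EuclideanSpace ℝ (Fin (m + 1))) i : 𝕜)) P
  continuous_toFun := by
    refine (MvPolynomial.continuous_eval P).comp (continuous_pi fun i => ?_)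
    exact RCLike.continuous_ofReal.comp (by fun_prop)

/-- The space `H_N` of spherical harmonics of degree `N` on `S^m`, with values in `𝕜`: the
restrictions to `S^m` of the harmonic homogeneous polynomials of degree `N` on `ℝ^(m+1)`. -/
noncomputable def sphericalHarmonics (m N : ℕ) : Submodule 𝕜 C(UnitSphere m, 𝕜) where
  carrier := {f | ∃ P : MvPolynomial (Fin (m + 1)) 𝕜,
    P.IsHomogeneous N ∧ polyLaplacian P = 0 ∧ restrictToSphere 𝕜 m P = f}
  zero_mem' := ⟨0, MvPolynomial.isHomogeneous_zero _ _ _, by simp [polyLaplacian],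
    by ext x; simp [restrictToSphere]⟩
  add_mem' := by
    rintro _ _ ⟨P, hP, hP', rfl⟩ ⟨Q, hQ, hQ', rfl⟩
    refine ⟨P + Q, hP.add hQ, ?_, by ext x; simp [restrictToSphere]⟩
    simp only [polyLaplacian, map_add, Finset.sum_add_distrib] at *
    rw [hP', hQ', add_zero]
  smul_mem' := by
    rintro c _ ⟨P, hP, hP', rfl⟩
    refine ⟨c • P, (MvPolynomial.homogeneousSubmodule _ _ N).smul_mem c hP, ?_,
      by ext x; simp [restrictToSphere]⟩
    have h : polyLaplacian (c • P) = c • polyLaplacian P := by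
      simp [polyLaplacian, Finset.smul_sum]
    rw [h, hP', smul_zero]

/-- `H_N` as a type of its own, so that it can carry the `L²` norm instead of the sup norm. -/
def SphericalHarmonic (m N : ℕ) : Type _ := ↥(sphericalHarmonics 𝕜 m N)

namespace SphericalHarmonic

variable {𝕜} {m N : ℕ}

noncomputable instance : AddCommGroup (SphericalHarmonic 𝕜 m N) :=
  inferInstanceAs (AddCommGroup ↥(sphericalHarmonics 𝕜 m N))

noncomputable instance : Module 𝕜 (SphericalHarmonic 𝕜 m N) :=
  inferInstanceAs (Module 𝕜 ↥(sphericalHarmonics 𝕜 m N))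

/-- The continuous function on `S^m` underlying a spherical harmonic. -/
def toContinuousMap (ψ : SphericalHarmonic 𝕜 m N) : C(UnitSphere m, 𝕜) := Subtype.val ψ

instance : CoeFun (SphericalHarmonic 𝕜 m N) fun _ => UnitSphere m → 𝕜 where
  coe ψ := ψ.toContinuousMap

theorem continuous_coe (ψ : SphericalHarmonic 𝕜 m N) : Continuous ψ := ψ.toContinuousMap.continuous

theorem add_apply (ψ φ : SphericalHarmonic 𝕜 m N) (x : UnitSphere m) :
    (ψ + φ) x = ψ x + φ x := rfl

theorem smul_apply (c : 𝕜) (ψ : SphericalHarmonic 𝕜 m N) (x : UnitSphere m) :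
    (c • ψ) x = c * ψ x := rfl

theorem integrable_conj_mul (ψ φ : SphericalHarmonic 𝕜 m N) :
    Integrable (fun x => conj (ψ x) * φ x) (surfaceMeasure m) :=
  ((RCLike.continuous_conj.comp ψ.continuous_coe).mul φ.continuous_coe).integrable_of_hasCompactSupport
    (HasCompactSupport.of_compactSpace _)

theorem conj_mul_self_eq (ψ : SphericalHarmonic 𝕜 m N) (x : UnitSphere m) :
    conj (ψ x) * ψ x = ((‖ψ x‖ ^ 2 : ℝ) : 𝕜) := by
  rw [RCLike.conj_mul]; push_cast; rfl

/-- The `L²` inner product `⟪ψ, φ⟫ = ∫ conj ψ * φ` over `S^m`. -/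
@[reducible] noncomputable def innerCore : InnerProductSpace.Core 𝕜 (SphericalHarmonic 𝕜 m N) where
  inner ψ φ := ∫ x, conj (ψ x) * φ x ∂(surfaceMeasure m)
  conj_inner_symm ψ φ := by
    rw [← integral_conj]
    congr 1 with x
    simp [mul_comm]
  re_inner_nonneg ψ := by
    simp_rw [conj_mul_self_eq]
    rw [integral_ofReal, RCLike.ofReal_re]
    positivity
  add_left ψ φ χ := by
    rw [← integral_add (integrable_conj_mul _ _) (integrable_conj_mul _ _)]
    congr 1 with x
    simp [add_apply, add_mul]
  smul_left ψ φ c := by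
    rw [← integral_const_mul]
    congr 1 with x
    simp [smul_apply, mul_assoc]
  definite ψ h := by
    simp_rw [conj_mul_self_eq] at h
    rw [integral_ofReal, RCLike.ofReal_eq_zero] at h
    have hc : Continuous fun x => ‖ψ x‖ ^ 2 := ψ.continuous_coe.norm.pow 2
    rw [integral_eq_zero_iff_of_nonneg (fun x => by positivity)
      (hc.integrable_of_hasCompactSupport (HasCompactSupport.of_compactSpace _))] at h
    have h' := (hc.ae_eq_iff_eq (surfaceMeasure m) continuous_zero).1 h
    refine Subtype.ext (ContinuousMap.ext fun x => ?_)
    have hx : ψ x = 0 := by simpa using congrFun h' x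
    exact hx

noncomputable instance : NormedAddCommGroup (SphericalHarmonic 𝕜 m N) :=
  innerCore.toNormedAddCommGroup

noncomputable instance : InnerProductSpace 𝕜 (SphericalHarmonic 𝕜 m N) :=
  InnerProductSpace.ofCore innerCore.toCore

/-- `H_N` as a real inner product space, with the real part of the `L²` inner product. -/
noncomputable instance instInnerReal : InnerProductSpace ℝ (SphericalHarmonic 𝕜 m N) :=
  InnerProductSpace.rclikeToReal 𝕜 (SphericalHarmonic 𝕜 m N)

theorem inner_eq (ψ φ : SphericalHarmonic 𝕜 m N) :
    inner 𝕜 ψ φ = ∫ x, conj (ψ x) * φ x ∂(surfaceMeasure m) := rfl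

theorem norm_sq_eq (ψ : SphericalHarmonic 𝕜 m N) :
    ‖ψ‖ ^ 2 = ∫ x, ‖ψ x‖ ^ 2 ∂(surfaceMeasure m) := by
  rw [← inner_self_eq_norm_sq (𝕜 := 𝕜) ψ, inner_eq]
  simp_rw [conj_mul_self_eq]
  rw [integral_ofReal, RCLike.ofReal_re]

instance : FiniteDimensional 𝕜 (SphericalHarmonic 𝕜 m N) := by
  let L : MvPolynomial (Fin (m + 1)) 𝕜 →ₗ[𝕜] C(UnitSphere m, 𝕜) :=
    { toFun := restrictToSphere 𝕜 m
      map_add' := fun P Q => by ext x; simp [restrictToSphere]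
      map_smul' := fun c P => by ext x; simp [restrictToSphere] }
  have hle : sphericalHarmonics 𝕜 m N ≤
      (MvPolynomial.homogeneousSubmodule (Fin (m + 1)) 𝕜 N).map L := by
    rintro _ ⟨P, hP, -, rfl⟩
    exact ⟨P, hP, rfl⟩
  have hfg := (MvPolynomial.homogeneousSubmodule_fg (Fin (m + 1)) 𝕜 N).map L
  have : FiniteDimensional 𝕜 ((MvPolynomial.homogeneousSubmodule (Fin (m + 1)) 𝕜 N).map L) :=
    Module.Finite.iff_fg.2 hfg
  exact Submodule.finiteDimensional_of_le hle

instance instFiniteReal : FiniteDimensional ℝ (SphericalHarmonic 𝕜 m N) := by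
  have : IsScalarTower ℝ 𝕜 (SphericalHarmonic 𝕜 m N) := RestrictScalars.isScalarTower ℝ 𝕜 _
  exact Module.Finite.trans 𝕜 (SphericalHarmonic 𝕜 m N)

noncomputable instance : MeasurableSpace (SphericalHarmonic 𝕜 m N) := borel _

instance : BorelSpace (SphericalHarmonic 𝕜 m N) := ⟨rfl⟩

/-- `sup_{x ∈ S^m} |ψ(x)|`. -/
noncomputable def supNorm (ψ : SphericalHarmonic 𝕜 m N) : ℝ := ⨆ x : UnitSphere m, ‖ψ x‖

end SphericalHarmonic

/-- The unit sphere `SH_N = {ψ ∈ H_N : ∫ |ψ|² = 1}`. -/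
abbrev UnitHarmonic (m N : ℕ) : Type _ := Metric.sphere (0 : SphericalHarmonic 𝕜 m N) 1

/-- The uniform probability measure `ν_N` on `SH_N`: the rotation invariant measure on the unit
sphere of the Euclidean space `H_N`, divided by its total mass. -/
noncomputable def uniformHarmonic (m N : ℕ) : Measure (UnitHarmonic 𝕜 m N) :=
  ProbabilityTheory.cond
    (Measure.addHaar : Measure (SphericalHarmonic 𝕜 m N)).toSphere Set.univ

/-- The probability space `∏_{N ≥ 1} SH_N` of independent random sequences, with `∏ ν_N`. -/
noncomputable def uniformHarmonicSeq (m : ℕ) : Measure (∀ N : ℕ+, UnitHarmonic 𝕜 m N) :=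
  Measure.infinitePi fun N : ℕ+ => uniformHarmonic 𝕜 m N

/-- The real and imaginary parts of `(x₀ + i x₁)^N` are harmonic, and the first is `1` at `e₀`. -/
theorem exists_harmonic_polynomial (m N : ℕ) (hm : 1 ≤ m) :
    ∃ P : MvPolynomial (Fin (m + 1)) 𝕜, P.IsHomogeneous N ∧ polyLaplacian P = 0 ∧
      MvPolynomial.eval (Pi.single 0 1) P = 1 := by
  obtain ⟨n, rfl⟩ : ∃ n, m = n + 1 := ⟨m - 1, by omega⟩
  suffices H : ∃ P Q : MvPolynomial (Fin (n + 1 + 1)) 𝕜, P.IsHomogeneous N ∧ Q.IsHomogeneous N ∧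
      MvPolynomial.pderiv 0 P = MvPolynomial.pderiv 1 Q ∧
      MvPolynomial.pderiv 1 P = -MvPolynomial.pderiv 0 Q ∧
      (∀ i : Fin (n + 1 + 1), i ≠ 0 → i ≠ 1 →
        MvPolynomial.pderiv i P = 0 ∧ MvPolynomial.pderiv i Q = 0) ∧
      MvPolynomial.eval (Pi.single 0 1) P = 1 by
    obtain ⟨P, Q, hP, -, h0, h1, hi, he⟩ := H
    refine ⟨P, hP, ?_, he⟩
    have hcomm : MvPolynomial.pderiv 0 (MvPolynomial.pderiv 1 Q) =
        MvPolynomial.pderiv 1 (MvPolynomial.pderiv 0 Q) := by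
      let D (i : Fin (n + 1 + 1)) : Derivation 𝕜 (MvPolynomial (Fin (n + 1 + 1)) 𝕜)
        (MvPolynomial (Fin (n + 1 + 1)) 𝕜) := MvPolynomial.pderiv i
      have hb : ⁅D 0, D 1⁆ = 0 := by
        refine MvPolynomial.derivation_ext fun i => ?_
        rw [Derivation.commutator_apply]
        simp [D, MvPolynomial.pderiv_X, Pi.single_apply, apply_ite]
      have hq := congrArg (fun E => E Q) hb
      simp only [Derivation.commutator_apply, Derivation.zero_apply] at hq
      exact sub_eq_zero.1 hq
    rw [polyLaplacian, Fin.sum_univ_succ, Fin.sum_univ_succ]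
    have hz : ∑ i : Fin n, MvPolynomial.pderiv i.succ.succ
        (MvPolynomial.pderiv i.succ.succ P) = 0 := by
      refine Finset.sum_eq_zero fun i _ => ?_
      rw [(hi i.succ.succ (Fin.succ_ne_zero _) ?_).1, map_zero]
      rw [← Fin.succ_zero_eq_one, Ne, Fin.succ_inj]
      exact Fin.succ_ne_zero _
    rw [hz, Fin.succ_zero_eq_one, h0, h1, map_neg, hcomm]
    simp
  induction N with
  | zero =>
    exact ⟨1, 0, MvPolynomial.isHomogeneous_one _ _, MvPolynomial.isHomogeneous_zero _ _ _,
      by simp, by simp, by simp, by simp⟩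
  | succ N ih =>
    obtain ⟨P, Q, hP, hQ, h0, h1, hi, he⟩ := ih
    have hX0 := MvPolynomial.isHomogeneous_X 𝕜 (0 : Fin (n + 1 + 1))
    have hX1 := MvPolynomial.isHomogeneous_X 𝕜 (1 : Fin (n + 1 + 1))
    have h01 : MvPolynomial.pderiv 0 (MvPolynomial.X 1 : MvPolynomial (Fin (n + 1 + 1)) 𝕜) = 0 :=
      MvPolynomial.pderiv_X_of_ne (by simp)
    have h10 : MvPolynomial.pderiv 1 (MvPolynomial.X 0 : MvPolynomial (Fin (n + 1 + 1)) 𝕜) = 0 :=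
      MvPolynomial.pderiv_X_of_ne (by simp)
    refine ⟨MvPolynomial.X 0 * P - MvPolynomial.X 1 * Q,
      MvPolynomial.X 0 * Q + MvPolynomial.X 1 * P, ?_, ?_, ?_, ?_, ?_, ?_⟩
    · simpa [add_comm] using (hX0.mul hP).sub (hX1.mul hQ)
    · simpa [add_comm] using (hX0.mul hQ).add (hX1.mul hP)
    · simp only [map_sub, map_add, MvPolynomial.pderiv_mul, MvPolynomial.pderiv_X_self, h01, h10,
        h0, h1]
      ring
    · simp only [map_sub, map_add, MvPolynomial.pderiv_mul, MvPolynomial.pderiv_X_self, h01, h10,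
        h0, h1]
      ring
    · intro i hi0 hi1
      have e0 : MvPolynomial.pderiv i (MvPolynomial.X 0 : MvPolynomial (Fin (n + 1 + 1)) 𝕜) = 0 :=
        MvPolynomial.pderiv_X_of_ne hi0.symm
      have e1 : MvPolynomial.pderiv i (MvPolynomial.X 1 : MvPolynomial (Fin (n + 1 + 1)) 𝕜) = 0 :=
        MvPolynomial.pderiv_X_of_ne hi1.symm
      simp [e0, e1, (hi i hi0 hi1).1, (hi i hi0 hi1).2]
    · simp [he]

theorem nontrivial_sphericalHarmonic (m N : ℕ) (hm : 1 ≤ m) :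
    Nontrivial (SphericalHarmonic 𝕜 m N) := by
  obtain ⟨P, hP, hP', he⟩ := exists_harmonic_polynomial 𝕜 m N hm
  refine ⟨⟨⟨restrictToSphere 𝕜 m P, P, hP, hP', rfl⟩, 0, fun h => ?_⟩⟩
  have hx := congrArg (fun ψ : SphericalHarmonic 𝕜 m N =>
    ψ ⟨EuclideanSpace.single 0 1, by simp⟩) h
  have h1 : restrictToSphere 𝕜 m P ⟨EuclideanSpace.single 0 1, by simp⟩ = 1 := by
    rw [← he]
    simp only [restrictToSphere, ContinuousMap.coe_mk]
    congr 2
    ext i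
    by_cases hi : i = 0
    · subst hi; simp
    · simp [hi]
  have h2 : restrictToSphere 𝕜 m P ⟨EuclideanSpace.single 0 1, by simp⟩ = 0 := hx
  exact one_ne_zero (h1.symm.trans h2)

theorem isProbabilityMeasure_uniformHarmonic (m N : ℕ) (hm : 1 ≤ m) :
    IsProbabilityMeasure (uniformHarmonic 𝕜 m N) := by
  have := nontrivial_sphericalHarmonic 𝕜 m N hm
  exact ProbabilityTheory.cond_isProbabilityMeasure
    (Measure.measure_univ_ne_zero.2 (Measure.toSphere_ne_zero Measure.addHaar))

theorem isProbabilityMeasure_uniformHarmonicSeq (m : ℕ) (hm : 1 ≤ m) :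
    IsProbabilityMeasure (uniformHarmonicSeq 𝕜 m) := by
  have (N : ℕ+) := isProbabilityMeasure_uniformHarmonic 𝕜 m N hm
  unfold uniformHarmonicSeq
  infer_instance

end SphericalHarmonics

/-!
The value at a point `x` of a random `ψ` on the unit sphere of `H_N` is subgaussian, uniformly in
`N` and `x`. Evaluation at `x` is the inner product with a vector whose squared norm is at most
`dim H_N / vol S^m` (`norm_sq_mul_le_finrank_mul_integral`: the reproducing kernel is constant on
the diagonal, because isometries act transitively on `S^m` and preserve `H_N`), and a linear form of
norm at most `1` exceeds `s` on at most a fraction `exp (-3 d s² / 8)` of the unit sphere in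
dimension `d` (`toSphere_cap_le`). The two dimensions cancel, so that `|ψ(x)| > t` has probability
at most `4 exp (-c t²)` with `c` proportional to `vol S^m`.

The passage from a point to the supremum uses no net and no gradient estimate. The power
`ψ ^ p` lies in the space of homogeneous polynomials of degree `N p` restricted to `S^m`, which is
again invariant under isometries and has dimension at most `D = (N p + 1) ^ (m + 1)`. The kernel
bound for that space gives `sup |ψ| ^ (2 p) ≤ (D / vol S^m) ∫ |ψ| ^ (2 p)`. If the set where
`|ψ| > t` has measure at most `vol S^m / (2 D)`, it contributes at most half of `sup |ψ| ^ (2 p)` to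
the right-hand side, and hence `sup |ψ| ≤ (2 D) ^ (1 / (2 p)) t` (`supNorm_pow_le`). By Fubini's
theorem and Markov's inequality the measure of that set is larger with probability at most
`8 D exp (-c t²)`. For `p = ⌈log N⌉` the factor `(2 D) ^ (1 / (2 p))` is bounded, while `D` is at most
a power of `N`; with `t` a large multiple of `√(log N)` this gives the tail bounds. The almost sure
statements follow by the Borel–Cantelli lemma, which needs no independence here.
-/

/-! ### Caps of the unit sphere -/

open scoped Pointwise in
/-- Concentration of measure on the unit sphere of a `d`-dimensional Euclidean space: a linear
form of norm at most `1` exceeds `s` on at most a fraction `exp (-3 d s² / 8)` of the sphere.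
The cone over the cap inside the unit ball lies in the ball of centre `(s / 2) v` and squared radius
`1 - 3 s² / 4`. -/
theorem toSphere_cap_le {E : Type*} [NormedAddCommGroup E] [InnerProductSpace ℝ E]
    [FiniteDimensional ℝ E] [MeasurableSpace E] [BorelSpace E] (μ : Measure E)
    [μ.IsAddHaarMeasure] {v : E} (hv : ‖v‖ ≤ 1) {s : ℝ} (hs : 0 ≤ s) :
    μ.toSphere {ω | s ≤ inner ℝ v (ω : E)} ≤
      ENNReal.ofReal (Real.exp (-(3 / 8) * Module.finrank ℝ E * s ^ 2)) *
        μ.toSphere Set.univ := by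
  rcases lt_or_ge 1 s with h1 | h1
  · have : {ω : Metric.sphere (0 : E) 1 | s ≤ inner ℝ v (ω : E)} = ∅ := by
      ext ω
      simp only [Set.mem_ofPred_eq, Set.mem_empty_iff_false, iff_false, not_le]
      have := real_inner_le_norm v (ω : E)
      rw [norm_eq_of_mem_sphere ω, mul_one] at this
      linarith
    simp [this]
  have hmeas : MeasurableSet {ω : Metric.sphere (0 : E) 1 | s ≤ inner ℝ v (ω : E)} :=
    (isClosed_le continuous_const (by fun_prop)).measurableSet
  rw [Measure.toSphere_apply' _ hmeas, Measure.toSphere_apply_univ]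
  have hpos : 0 < 1 - 3 * s ^ 2 / 4 := by nlinarith
  set ρ := Real.sqrt (1 - 3 * s ^ 2 / 4) with hρ
  have hρpos : 0 < ρ := Real.sqrt_pos.2 hpos
  have hsub : Set.Ioo (0 : ℝ) 1 • ((↑) '' {ω : Metric.sphere (0 : E) 1 | s ≤ inner ℝ v (ω : E)}) ⊆
      Metric.ball ((s / 2) • v) (ρ * 1) := by
    rintro _ ⟨r, ⟨hr0, hr1⟩, _, ⟨ω, hω, rfl⟩, rfl⟩
    have hω' : s ≤ inner ℝ v (ω : E) := hω
    rw [mem_ball_iff_norm, mul_one]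
    refine Real.lt_sqrt_of_sq_lt ?_
    simp only
    rw [norm_sub_sq_real, norm_smul, norm_smul, norm_eq_of_mem_sphere ω, inner_smul_left,
      inner_smul_right, real_inner_comm]
    simp only [Real.norm_eq_abs, conj_trivial, mul_one, sq_abs, mul_pow]
    have hv2 : ‖v‖ ^ 2 ≤ 1 := pow_le_one₀ (norm_nonneg _) hv
    have e1 : r * s * s ≤ r * s * inner ℝ v (ω : E) := by gcongr
    have e2 : (s / 2) ^ 2 * ‖v‖ ^ 2 ≤ (s / 2) ^ 2 := by nlinarith [sq_nonneg (s / 2)]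
    -- The required bound `r² - r s² + s² / 4 < 1 - 3 s² / 4` factors in this way.
    have e3 : 0 < (1 - r) * (1 + r - s ^ 2) := by
      apply mul_pos (by linarith); nlinarith
    nlinarith
  have hball := (measure_mono hsub).trans_eq (Measure.addHaar_ball_mul_of_pos μ _ hρpos 1)
  have hexp : ρ ^ Module.finrank ℝ E ≤
      Real.exp (-(3 / 8) * Module.finrank ℝ E * s ^ 2) := by
    have : ρ ≤ Real.exp (-(3 / 8) * s ^ 2) := by
      refine Real.sqrt_le_iff.2 ⟨(Real.exp_pos _).le, ?_⟩
      rw [← Real.exp_nat_mul]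
      have := Real.add_one_le_exp (-(3 * s ^ 2 / 4))
      refine le_trans (by linarith) (this.trans_eq ?_)
      congr 1; push_cast; ring
    refine (pow_le_pow_left₀ hρpos.le this _).trans_eq ?_
    rw [← Real.exp_nat_mul]
    congr 1; ring
  calc _ ≤ (Module.finrank ℝ E : ENNReal) *
        (ENNReal.ofReal (ρ ^ Module.finrank ℝ E) * μ (Metric.ball 0 1)) := by gcongr
    _ ≤ (Module.finrank ℝ E : ENNReal) *
        (ENNReal.ofReal (Real.exp (-(3 / 8) * Module.finrank ℝ E * s ^ 2)) *
          μ (Metric.ball 0 1)) := by gcongr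
    _ = _ := by ring

/-! ### Isometries of the sphere -/

/-- The action of a linear isometry of `ℝ^(m+1)` on `S^m`. -/
noncomputable def sphereMap {m : ℕ}
    (R : EuclideanSpace ℝ (Fin (m + 1)) ≃ₗᵢ[ℝ] EuclideanSpace ℝ (Fin (m + 1))) :
    C(UnitSphere m, UnitSphere m) where
  toFun x := ⟨R x, by simp⟩
  continuous_toFun := by fun_prop

open scoped Pointwise in
theorem measurePreserving_sphereMap {m : ℕ}
    (R : EuclideanSpace ℝ (Fin (m + 1)) ≃ₗᵢ[ℝ] EuclideanSpace ℝ (Fin (m + 1))) :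
    MeasurePreserving (sphereMap R) (surfaceMeasure m) (surfaceMeasure m) := by
  refine ⟨(sphereMap R).continuous.measurable, ?_⟩
  ext s hs
  rw [Measure.map_apply (sphereMap R).continuous.measurable hs, surfaceMeasure,
    Measure.toSphere_apply' _ ((sphereMap R).continuous.measurable hs),
    Measure.toSphere_apply' _ hs]
  congr 1
  rw [← R.measurePreserving.measure_preimage_equiv (f := R.toMeasurableEquiv)
    (Set.Ioo (0 : ℝ) 1 • (((↑) : UnitSphere m → EuclideanSpace ℝ (Fin (m + 1))) '' s))]
  congr 1
  ext x
  constructor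
  · rintro ⟨r, hr, _, ⟨ω, hω, rfl⟩, rfl⟩
    exact ⟨r, hr, _, ⟨sphereMap R ω, hω, rfl⟩, by simp [sphereMap]⟩
  · rintro ⟨r, hr, _, ⟨ω, hω, rfl⟩, hx⟩
    refine ⟨r, hr, R.symm ω, ⟨⟨R.symm ω, by simp⟩, ?_, rfl⟩, ?_⟩
    · simpa [sphereMap] using hω
    · have : r • (ω : EuclideanSpace ℝ (Fin (m + 1))) = R x := hx
      apply R.injective
      simpa using this

/-- The isometries of the sphere act transitively. -/
theorem exists_sphereMap_eq {m : ℕ} (x y : UnitSphere m) : ∃ R, sphereMap R x = y := by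
  refine ⟨(Submodule.span ℝ {(x : EuclideanSpace ℝ (Fin (m + 1))) - y})ᗮ.reflection, ?_⟩
  refine Subtype.ext (Submodule.reflection_sub ?_)
  rw [norm_eq_of_mem_sphere x, norm_eq_of_mem_sphere y]

/-! ### Polynomials under linear substitutions -/

/-- The chain rule for a linear substitution. -/
theorem MvPolynomial.pderiv_aeval_linear {R σ : Type*} [CommRing R] [Fintype σ]
    [DecidableEq σ] (U : σ → σ → R) (P : MvPolynomial σ R) (i : σ) :
    pderiv i (aeval (fun j => ∑ k, C (U j k) * X k) P) =
      ∑ j, C (U j i) * aeval (fun j => ∑ k, C (U j k) * X k) (pderiv j P) := by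
  induction P using MvPolynomial.induction_on with
  | C a => simp
  | add p q hp hq => simp only [map_add, hp, hq, mul_add, Finset.sum_add_distrib]
  | mul_X p n hp =>
    have h : pderiv i (∑ k, C (U n k) * X k) = C (U n i) := by
      simp [map_sum, pderiv_X, Pi.single_apply]
    simp only [map_mul, pderiv_mul, hp, aeval_X, h, map_add, mul_add, Finset.sum_add_distrib,
      Finset.sum_mul]
    congr 1
    · exact Finset.sum_congr rfl fun j _ => by ring
    · rw [Finset.sum_eq_single n]
      · simp; ring
      · intro j _ hj
        simp [pderiv_X_of_ne hj.symm]
      · simp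

/-- The Laplacian commutes with orthogonal substitutions. -/
theorem polyLaplacian_aeval_linear {R σ : Type*} [CommRing R] [Fintype σ] [DecidableEq σ]
    (U : σ → σ → R) (hU : ∀ j k, ∑ i, U j i * U k i = if j = k then 1 else 0)
    (P : MvPolynomial σ R) :
    polyLaplacian (MvPolynomial.aeval
        (fun j => ∑ k, MvPolynomial.C (U j k) * MvPolynomial.X k) P) =
      MvPolynomial.aeval (fun j => ∑ k, MvPolynomial.C (U j k) * MvPolynomial.X k)
        (polyLaplacian P) := by
  simp only [polyLaplacian, MvPolynomial.pderiv_aeval_linear, map_sum, MvPolynomial.pderiv_C_mul,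
    Finset.mul_sum]
  rw [Finset.sum_comm]
  refine Finset.sum_congr rfl fun j _ => ?_
  rw [Finset.sum_comm]
  have (k : σ) : ∑ i, MvPolynomial.C (U j i) * (MvPolynomial.C (U k i) *
      MvPolynomial.aeval (fun j => ∑ k, MvPolynomial.C (U j k) * MvPolynomial.X k)
        (MvPolynomial.pderiv k (MvPolynomial.pderiv j P))) =
      MvPolynomial.C (if j = k then 1 else 0) *
      MvPolynomial.aeval (fun j => ∑ k, MvPolynomial.C (U j k) * MvPolynomial.X k)
        (MvPolynomial.pderiv k (MvPolynomial.pderiv j P)) := by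
    rw [← hU j k, map_sum, Finset.sum_mul]
    exact Finset.sum_congr rfl fun i _ => by rw [map_mul]; ring
  simp only [this]
  simp


/-! ### Invariant spaces of functions on the sphere -/

section Restriction

variable (𝕜 : Type*) [RCLike 𝕜]

theorem restrictToSphere_comp_sphereMap {m : ℕ} (P : MvPolynomial (Fin (m + 1)) 𝕜)
    (R : EuclideanSpace ℝ (Fin (m + 1)) ≃ₗᵢ[ℝ] EuclideanSpace ℝ (Fin (m + 1))) :
    (restrictToSphere 𝕜 m P).comp (sphereMap R) =
      restrictToSphere 𝕜 m (MvPolynomial.aeval (fun j => ∑ k,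
        MvPolynomial.C ((R (EuclideanSpace.single k 1) j : ℝ) : 𝕜) * MvPolynomial.X k) P) := by
  ext x
  simp only [restrictToSphere, ContinuousMap.comp_apply, ContinuousMap.coe_mk]
  rw [← MvPolynomial.coe_aeval_eq_eval, ← MvPolynomial.coe_aeval_eq_eval]
  simp only [RingHom.coe_coe]
  rw [MvPolynomial.comp_aeval_apply]
  congr 2
  ext j
  have hx : (x : EuclideanSpace ℝ (Fin (m + 1))) =
      ∑ k, (x : EuclideanSpace ℝ (Fin (m + 1))) k • EuclideanSpace.single k (1 : ℝ) := by
    ext i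
    simp [Finset.sum_apply, Pi.single_apply]
  have : (R x) j = ∑ k, R (EuclideanSpace.single k 1) j *
      (x : EuclideanSpace ℝ (Fin (m + 1))) k := by
    conv_lhs => rw [hx]
    simp [mul_comm]
  simp [sphereMap, this]

/-- Spherical harmonics are stable under isometries, since the Laplacian commutes with the
corresponding orthogonal substitutions. -/
theorem comp_sphereMap_mem_sphericalHarmonics {m N : ℕ} {f : C(UnitSphere m, 𝕜)}
    (hf : f ∈ sphericalHarmonics 𝕜 m N)
    (R : EuclideanSpace ℝ (Fin (m + 1)) ≃ₗᵢ[ℝ] EuclideanSpace ℝ (Fin (m + 1))) :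
    f.comp (sphereMap R) ∈ sphericalHarmonics 𝕜 m N := by
  obtain ⟨P, hP, hP', rfl⟩ := hf
  refine ⟨_, ?_, ?_, (restrictToSphere_comp_sphereMap 𝕜 P R).symm⟩
  · rw [← one_mul N]
    refine hP.aeval _ fun j => MvPolynomial.IsHomogeneous.sum _ _ _ fun k _ => ?_
    exact (MvPolynomial.isHomogeneous_X 𝕜 k).C_mul _
  · -- The rows of the matrix of `R` are orthonormal: they are the vectors `R⁻¹ eⱼ`.
    have hU (j k : Fin (m + 1)) : ∑ i, ((R (EuclideanSpace.single i 1) j : ℝ) : 𝕜) *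
        ((R (EuclideanSpace.single i 1) k : ℝ) : 𝕜) = if j = k then 1 else 0 := by
      have h := (EuclideanSpace.basisFun (Fin (m + 1)) ℝ).sum_inner_mul_inner
        (R.symm (EuclideanSpace.single j 1)) (R.symm (EuclideanSpace.single k 1))
      have hR (i j : Fin (m + 1)) : inner ℝ (R.symm (EuclideanSpace.single j 1))
          (EuclideanSpace.single i (1 : ℝ)) = R (EuclideanSpace.single i 1) j := by
        rw [← R.inner_map_map]
        simp [EuclideanSpace.inner_single_left]
      have hR' (i j : Fin (m + 1)) : inner ℝ (EuclideanSpace.single i (1 : ℝ))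
          (R.symm (EuclideanSpace.single j 1)) = R (EuclideanSpace.single i 1) j := by
        rw [real_inner_comm, hR]
      simp only [EuclideanSpace.basisFun_apply, hR, hR', LinearIsometryEquiv.inner_map_map] at h
      rw [← map_one (algebraMap ℝ 𝕜), ← map_zero (algebraMap ℝ 𝕜)]
      norm_cast
      rw [h]
      simp [EuclideanSpace.inner_single_left]
    rw [polyLaplacian_aeval_linear _ hU, hP', map_zero]

/-- The restrictions to `S^m` of the homogeneous polynomials of degree `M`. -/
noncomputable def homogeneousOnSphere (m M : ℕ) : Submodule 𝕜 C(UnitSphere m, 𝕜) :=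
  (MvPolynomial.homogeneousSubmodule (Fin (m + 1)) 𝕜 M).map
    ({ toFun := restrictToSphere 𝕜 m
       map_add' := fun P Q => by ext x; simp [restrictToSphere]
       map_smul' := fun c P => by ext x; simp [restrictToSphere] } :
      MvPolynomial (Fin (m + 1)) 𝕜 →ₗ[𝕜] C(UnitSphere m, 𝕜))

theorem comp_sphereMap_mem_homogeneousOnSphere {m M : ℕ} {f : C(UnitSphere m, 𝕜)}
    (hf : f ∈ homogeneousOnSphere 𝕜 m M)
    (R : EuclideanSpace ℝ (Fin (m + 1)) ≃ₗᵢ[ℝ] EuclideanSpace ℝ (Fin (m + 1))) :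
    f.comp (sphereMap R) ∈ homogeneousOnSphere 𝕜 m M := by
  obtain ⟨P, hP, rfl⟩ := hf
  refine ⟨_, ?_, (restrictToSphere_comp_sphereMap 𝕜 P R).symm⟩
  rw [SetLike.mem_coe, MvPolynomial.mem_homogeneousSubmodule, ← one_mul M]
  refine MvPolynomial.IsHomogeneous.aeval hP _ fun j =>
    MvPolynomial.IsHomogeneous.sum _ _ _ fun k _ => ?_
  exact (MvPolynomial.isHomogeneous_X 𝕜 k).C_mul _

instance (m M : ℕ) : FiniteDimensional 𝕜 (homogeneousOnSphere 𝕜 m M) :=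
  Module.Finite.iff_fg.2 ((MvPolynomial.homogeneousSubmodule_fg (Fin (m + 1)) 𝕜 M).map _)

/-- The space is spanned by monomials in which every exponent is at most `M`. -/
theorem finrank_homogeneousOnSphere_le (m M : ℕ) :
    Module.finrank 𝕜 (homogeneousOnSphere 𝕜 m M) ≤ (M + 1) ^ (m + 1) := by
  let b : (Fin (m + 1) → Fin (M + 1)) → C(UnitSphere m, 𝕜) := fun a =>
    restrictToSphere 𝕜 m (∏ i, MvPolynomial.X i ^ (a i : ℕ))
  have hle : homogeneousOnSphere 𝕜 m M ≤ Submodule.span 𝕜 (Set.range b) := by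
    rintro _ ⟨P, hP, rfl⟩
    have hP : P.IsHomogeneous M := hP
    have : restrictToSphere 𝕜 m P = ∑ d ∈ P.support, MvPolynomial.coeff d P •
        restrictToSphere 𝕜 m (∏ i, MvPolynomial.X i ^ d i) := by
      ext x
      simp only [restrictToSphere, ContinuousMap.coe_mk]
      rw [MvPolynomial.eval_eq']
      simp [ContinuousMap.sum_apply]
    change restrictToSphere 𝕜 m P ∈ _
    rw [this]
    refine Submodule.sum_mem _ fun d hd => Submodule.smul_mem _ _ (Submodule.subset_span ?_)
    have hd' (i : Fin (m + 1)) : d i < M + 1 := by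
      have h := hP (MvPolynomial.mem_support_iff.1 hd)
      rw [Finsupp.weight_apply, Finsupp.sum_fintype _ _ (by simp)] at h
      simp only [Pi.one_apply, smul_eq_mul, mul_one] at h
      have := Finset.single_le_sum (f := fun i => d i) (fun _ _ => Nat.zero_le _)
        (Finset.mem_univ i)
      omega
    exact ⟨fun i => ⟨d i, hd' i⟩, rfl⟩
  have : FiniteDimensional 𝕜 (Submodule.span 𝕜 (Set.range b)) :=
    FiniteDimensional.span_of_finite 𝕜 (Set.finite_range b)
  refine (Submodule.finrank_mono hle).trans ((finrank_range_le_card (R := 𝕜) b).trans_eq ?_)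
  simp

theorem pow_mem_homogeneousOnSphere {m N : ℕ} {f : C(UnitSphere m, 𝕜)}
    (hf : f ∈ sphericalHarmonics 𝕜 m N) (p : ℕ) :
    f ^ p ∈ homogeneousOnSphere 𝕜 m (N * p) := by
  obtain ⟨P, hP, -, rfl⟩ := hf
  refine ⟨P ^ p, hP.pow p, ?_⟩
  ext x
  simp [restrictToSphere]

end Restriction

/-! ### The reproducing kernel of an invariant space -/

/-- The sup norm is controlled by the `L²` norm on a finite-dimensional space `V` of functions on
the sphere that is invariant under isometries. With an orthonormal basis `(eᵢ)` of `V`, the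
kernel `K x = ∑ |eᵢ(x)|²` on the diagonal is constant, because the isometries act
transitively, and its integral is `dim V`. -/
theorem norm_sq_mul_le_finrank_mul_integral {𝕜 : Type*} [RCLike 𝕜] {m : ℕ}
    (V : Submodule 𝕜 C(UnitSphere m, 𝕜)) [FiniteDimensional 𝕜 V]
    (hV : ∀ f ∈ V, ∀ R, f.comp (sphereMap R) ∈ V) {f : C(UnitSphere m, 𝕜)} (hf : f ∈ V)
    (x : UnitSphere m) :
    ‖f x‖ ^ 2 * (surfaceMeasure m).real Set.univ ≤
      Module.finrank 𝕜 V * ∫ y, ‖f y‖ ^ 2 ∂(surfaceMeasure m) := by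
  set σ := surfaceMeasure m
  let T : C(UnitSphere m, 𝕜) →L[𝕜] Lp 𝕜 2 σ := ContinuousMap.toLp 2 σ 𝕜
  have hT : Function.Injective T := ContinuousMap.toLp_injective σ
  have hint (g : C(UnitSphere m, 𝕜)) : Integrable (fun y => ‖g y‖ ^ 2) σ :=
    (g.continuous.norm.pow 2).integrable_of_hasCompactSupport (HasCompactSupport.of_compactSpace _)
  have hnorm (g : C(UnitSphere m, 𝕜)) : ‖T g‖ ^ 2 = ∫ y, ‖g y‖ ^ 2 ∂σ := by
    have h := ContinuousMap.inner_toLp (𝕜 := 𝕜) σ g g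
    rw [inner_self_eq_norm_sq_to_K] at h
    simp_rw [RCLike.mul_conj] at h
    norm_cast at h
  let W : Submodule 𝕜 (Lp 𝕜 2 σ) := V.map (T : C(UnitSphere m, 𝕜) →ₗ[𝕜] Lp 𝕜 2 σ)
  have hW : Module.finrank 𝕜 W = Module.finrank 𝕜 V :=
    (Submodule.equivMapOfInjective (T : C(UnitSphere m, 𝕜) →ₗ[𝕜] Lp 𝕜 2 σ) hT V).finrank_eq.symm
  let b := stdOrthonormalBasis 𝕜 W
  have hb (i) : ∃ e ∈ V, T e = (b i : Lp 𝕜 2 σ) := (b i).2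
  choose e heV he using hb
  have hexp (g : C(UnitSphere m, 𝕜)) (hg : g ∈ V) :
      ∃ c : _ → 𝕜, g = ∑ i, c i • e i ∧ ∑ i, ‖c i‖ ^ 2 = ∫ y, ‖g y‖ ^ 2 ∂σ := by
    let w : W := ⟨T g, g, hg, rfl⟩
    refine ⟨fun i => inner 𝕜 (b i) w, hT ?_, ?_⟩
    · rw [map_sum]
      simp_rw [map_smul, he]
      have := congrArg (Subtype.val) (b.sum_repr' w)
      simpa using this.symm
    · rw [b.sum_sq_norm_inner_right w, ← hnorm]
      rfl
  have he1 (i) : ∫ y, ‖e i y‖ ^ 2 ∂σ = 1 := by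
    rw [← hnorm, he, ← Submodule.coe_norm, b.norm_eq_one, one_pow]
  let K : UnitSphere m → ℝ := fun y => ∑ i, ‖e i y‖ ^ 2
  have hK0 (y) : 0 ≤ K y := Finset.sum_nonneg fun _ _ => by positivity
  have hCS (g : C(UnitSphere m, 𝕜)) (hg : g ∈ V) (y : UnitSphere m) :
      ‖g y‖ ^ 2 ≤ (∫ y, ‖g y‖ ^ 2 ∂σ) * K y := by
    obtain ⟨c, hc, hc'⟩ := hexp g hg
    rw [← hc']
    calc ‖g y‖ ^ 2 = ‖∑ i, c i * e i y‖ ^ 2 := by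
          conv_lhs => rw [hc]
          simp [ContinuousMap.sum_apply]
      _ ≤ (∑ i, ‖c i‖ * ‖e i y‖) ^ 2 := by
          gcongr
          exact (norm_sum_le _ _).trans_eq (by simp)
      _ ≤ _ := Finset.sum_mul_sq_le_sq_mul_sq _ _ _
  -- The function `k` represents evaluation at `z`; moving it to `y` compares `K z` with `K y`.
  have hKle (z y : UnitSphere m) : K z ≤ K y := by
    obtain ⟨R, hR⟩ := exists_sphereMap_eq y z
    let k : C(UnitSphere m, 𝕜) := ∑ i, conj (e i z) • e i
    have hkV : k ∈ V := Submodule.sum_mem _ fun i _ => V.smul_mem _ (heV i)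
    have hkz : k z = (K z : 𝕜) := by
      simp [k, K, ContinuousMap.sum_apply, RCLike.conj_mul]
    have hk : ∫ y, ‖k y‖ ^ 2 ∂σ = K z := by
      have : T k = ((∑ i, conj (e i z) • b i : W) : Lp 𝕜 2 σ) := by
        simp [k, map_sum, he]
      rw [← hnorm, this, ← Submodule.coe_norm, ← b.sum_sq_norm_inner_right]
      simp_rw [b.orthonormal.inner_right_fintype, RCLike.norm_conj]
      rfl
    have h := hCS _ (hV k hkV R) y
    have hinv : ∫ y, ‖k.comp (sphereMap R) y‖ ^ 2 ∂σ = K z := by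
      have hmp : MeasurePreserving (sphereMap R) σ σ := measurePreserving_sphereMap R
      have := integral_map hmp.measurable.aemeasurable
        (hmp.map_eq ▸ (hint k).aestronglyMeasurable)
      rw [hmp.map_eq] at this
      exact this.symm.trans hk
    rw [hinv, ContinuousMap.comp_apply, hR, hkz] at h
    simp only [RCLike.norm_ofReal, sq_abs] at h
    rcases (hK0 z).eq_or_lt with h0 | h0
    · rw [← h0]; exact hK0 y
    · rw [sq] at h
      exact le_of_mul_le_mul_left h h0
  -- Integrating the constant function `K` gives the trace of the identity of `V`.
  have hKint : ∫ y, K y ∂σ = Module.finrank 𝕜 V := by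
    rw [integral_finsetSum _ fun i _ => hint (e i)]
    simp [he1, hW]
  have hKx : K x * σ.real Set.univ ≤ Module.finrank 𝕜 V := by
    rw [← hKint, mul_comm, ← smul_eq_mul, ← integral_const]
    exact integral_mono (integrable_const _) (integrable_finsetSum _ fun i _ => hint (e i))
      (fun y => hKle x y)
  have hI : 0 ≤ ∫ y, ‖f y‖ ^ 2 ∂σ := integral_nonneg fun y => by positivity
  calc ‖f x‖ ^ 2 * σ.real Set.univ ≤ ((∫ y, ‖f y‖ ^ 2 ∂σ) * K x) * σ.real Set.univ := by
        gcongr; exact hCS f hf x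
    _ = (K x * σ.real Set.univ) * ∫ y, ‖f y‖ ^ 2 ∂σ := by ring
    _ ≤ _ := by gcongr

/-! ### Tails of the values of a random spherical harmonic -/

namespace SphericalHarmonic

variable {𝕜 : Type*} [RCLike 𝕜] {m N : ℕ}

theorem norm_apply_sq_mul_le (ψ : SphericalHarmonic 𝕜 m N) (x : UnitSphere m) :
    ‖ψ x‖ ^ 2 * (surfaceMeasure m).real Set.univ ≤
      Module.finrank 𝕜 (SphericalHarmonic 𝕜 m N) * ‖ψ‖ ^ 2 := by
  have : FiniteDimensional 𝕜 (sphericalHarmonics 𝕜 m N) :=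
    inferInstanceAs (FiniteDimensional 𝕜 (SphericalHarmonic 𝕜 m N))
  rw [norm_sq_eq]
  exact norm_sq_mul_le_finrank_mul_integral (sphericalHarmonics 𝕜 m N)
    (fun f hf R => comp_sphereMap_mem_sphericalHarmonics 𝕜 hf R) ψ.2 x

theorem surfaceMeasure_real_univ_pos (m : ℕ) : 0 < (surfaceMeasure m).real Set.univ := by
  exact ENNReal.toReal_pos
    (isOpen_univ.measure_pos _ ⟨⟨EuclideanSpace.single 0 1, by simp⟩, trivial⟩).ne'
    (measure_ne_top _ _)

/-- Evaluation at a point, as a linear functional. -/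
noncomputable def evalAt (x : UnitSphere m) : SphericalHarmonic 𝕜 m N →ₗ[𝕜] 𝕜 where
  toFun ψ := ψ x
  map_add' ψ φ := add_apply ψ φ x
  map_smul' c ψ := smul_apply c ψ x

/-- Evaluation at `x` is the inner product with a spherical harmonic whose `L²` norm is at most
`√(dim H_N / vol S^m)`. -/
theorem exists_inner_eq_apply (x : UnitSphere m) :
    ∃ k : SphericalHarmonic 𝕜 m N, (∀ ψ : SphericalHarmonic 𝕜 m N, inner 𝕜 k ψ = ψ x) ∧
      ‖k‖ ^ 2 * (surfaceMeasure m).real Set.univ ≤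
        Module.finrank 𝕜 (SphericalHarmonic 𝕜 m N) := by
  have : CompleteSpace (SphericalHarmonic 𝕜 m N) := FiniteDimensional.complete 𝕜 _
  let ℓ : SphericalHarmonic 𝕜 m N →L[𝕜] 𝕜 := LinearMap.toContinuousLinearMap (evalAt x)
  have hk (ψ : SphericalHarmonic 𝕜 m N) :
      inner 𝕜 ((InnerProductSpace.toDual 𝕜 _).symm ℓ) ψ = ψ x :=
    InnerProductSpace.toDual_symm_apply
  refine ⟨(InnerProductSpace.toDual 𝕜 _).symm ℓ, hk, ?_⟩
  set k := (InnerProductSpace.toDual 𝕜 (SphericalHarmonic 𝕜 m N)).symm ℓ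
  have h := norm_apply_sq_mul_le k x
  rw [← hk, inner_self_eq_norm_sq_to_K, norm_pow, RCLike.norm_ofReal, abs_norm] at h
  rcases (norm_nonneg k).eq_or_lt with h0 | h0
  · rw [← h0]; simp
  · have h2 : 0 < ‖k‖ ^ 2 := by positivity
    refine le_of_mul_le_mul_right ?_ h2
    linarith

theorem finrank_le_finrank_real :
    Module.finrank 𝕜 (SphericalHarmonic 𝕜 m N) ≤ Module.finrank ℝ (SphericalHarmonic 𝕜 m N) := by
  have : IsScalarTower ℝ 𝕜 (SphericalHarmonic 𝕜 m N) := RestrictScalars.isScalarTower ℝ 𝕜 _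
  rw [← Module.finrank_mul_finrank ℝ 𝕜 (SphericalHarmonic 𝕜 m N)]
  exact Nat.le_mul_of_pos_left _ Module.finrank_pos

/-- `toSphere_cap_le` for the linear form `ψ ↦ re (u ψ(x))`: the dimension in the exponent cancels
against the one in the bound of `exists_inner_eq_apply`. -/
theorem uniformHarmonic_re_mul_ge_le (hm : 1 ≤ m) (x : UnitSphere m) {u : 𝕜} (hu : ‖u‖ ≤ 1)
    {t : ℝ} (ht : 0 ≤ t) :
    uniformHarmonic 𝕜 m N
        {ψ | t ≤ RCLike.re (u * (ψ : SphericalHarmonic 𝕜 m N) x)} ≤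
      ENNReal.ofReal (Real.exp (-(3 / 8) * (surfaceMeasure m).real Set.univ * t ^ 2)) := by
  have := nontrivial_sphericalHarmonic 𝕜 m N hm
  set vol := (surfaceMeasure m).real Set.univ with hvol
  have hvol0 : 0 < vol := surfaceMeasure_real_univ_pos m
  set d := Module.finrank 𝕜 (SphericalHarmonic 𝕜 m N) with hd
  have hd0 : (0 : ℝ) < d := by exact_mod_cast Module.finrank_pos
  obtain ⟨k, hk, hkn⟩ := exists_inner_eq_apply (𝕜 := 𝕜) (N := N) x
  set c : ℝ := Real.sqrt (d / vol) with hc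
  have hc2 : c ^ 2 = d / vol := Real.sq_sqrt (by positivity)
  have hc0 : 0 < c := Real.sqrt_pos.2 (by positivity)
  have hkc : ‖k‖ ≤ c := Real.le_sqrt_of_sq_le (by rwa [le_div_iff₀ hvol0])
  let v : SphericalHarmonic 𝕜 m N := ((c⁻¹ : ℝ) : 𝕜) • conj u • k
  have hv : ‖v‖ ≤ 1 := by
    rw [norm_smul, norm_smul, RCLike.norm_conj, RCLike.norm_ofReal, abs_of_pos (inv_pos.2 hc0)]
    calc c⁻¹ * (‖u‖ * ‖k‖) ≤ c⁻¹ * (1 * c) := by gcongr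
      _ = 1 := by field_simp
  have hset : {ψ : UnitHarmonic 𝕜 m N | t ≤ RCLike.re (u * (ψ : SphericalHarmonic 𝕜 m N) x)} =
      {ψ : UnitHarmonic 𝕜 m N | t / c ≤ inner ℝ v (ψ : SphericalHarmonic 𝕜 m N)} := by
    ext ψ
    have : inner ℝ v (ψ : SphericalHarmonic 𝕜 m N) =
        RCLike.re (u * (ψ : SphericalHarmonic 𝕜 m N) x) / c := by
      change RCLike.re (inner 𝕜 v (ψ : SphericalHarmonic 𝕜 m N)) = _
      rw [inner_smul_left, inner_smul_left, hk, RCLike.conj_conj, RCLike.conj_ofReal,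
        RCLike.re_ofReal_mul]
      ring
    simp only [Set.mem_ofPred_eq, this, div_le_div_iff_of_pos_right hc0]
  have hcap := toSphere_cap_le (Measure.addHaar : Measure (SphericalHarmonic 𝕜 m N)) hv
    (div_nonneg ht hc0.le)
  rw [uniformHarmonic, ProbabilityTheory.cond_apply MeasurableSet.univ, Set.univ_inter, hset]
  set τ := (Measure.addHaar : Measure (SphericalHarmonic 𝕜 m N)).toSphere
  have hτ0 : τ Set.univ ≠ 0 := Measure.measure_univ_ne_zero.2 (Measure.toSphere_ne_zero _)
  calc (τ Set.univ)⁻¹ * τ {ψ : UnitHarmonic 𝕜 m N | t / c ≤ inner ℝ v (ψ : SphericalHarmonic 𝕜 m N)} ≤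
        (τ Set.univ)⁻¹ * (_ * τ Set.univ) := by gcongr
    _ = _ := by
      rw [mul_comm, mul_assoc, ENNReal.mul_inv_cancel hτ0 (measure_ne_top _ _), mul_one]
    _ ≤ _ := by
      refine ENNReal.ofReal_le_ofReal (Real.exp_le_exp.2 ?_)
      have hdR : (d : ℝ) ≤ Module.finrank ℝ (SphericalHarmonic 𝕜 m N) := by
        exact_mod_cast finrank_le_finrank_real
      have : vol * t ^ 2 ≤ Module.finrank ℝ (SphericalHarmonic 𝕜 m N) * (t / c) ^ 2 := by
        rw [div_pow, hc2]
        calc vol * t ^ 2 = d * (t ^ 2 / (d / vol)) := by field_simp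
          _ ≤ _ := by gcongr
      linarith

/-- The value of a random spherical harmonic at a point is subgaussian, uniformly in the degree. -/
theorem uniformHarmonic_norm_apply_gt_le (hm : 1 ≤ m) (x : UnitSphere m) {t : ℝ} (ht : 0 ≤ t) :
    uniformHarmonic 𝕜 m N {ψ | t < ‖(ψ : SphericalHarmonic 𝕜 m N) x‖} ≤
      4 * ENNReal.ofReal (Real.exp (-(3 / 32) * (surfaceMeasure m).real Set.univ * t ^ 2)) := by
  -- If `|z| > t`, one of `± re z`, `± im z` is at least `t / 2`.
  let s (u : 𝕜) : Set (UnitHarmonic 𝕜 m N) :=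
    {ψ | t / 2 ≤ RCLike.re (u * (ψ : SphericalHarmonic 𝕜 m N) x)}
  have hs {u : 𝕜} (hu : ‖u‖ ≤ 1) : uniformHarmonic 𝕜 m N (s u) ≤
      ENNReal.ofReal (Real.exp (-(3 / 32) * (surfaceMeasure m).real Set.univ * t ^ 2)) := by
    refine (uniformHarmonic_re_mul_ge_le hm x hu (by positivity)).trans_eq ?_
    congr 2; ring
  have hI : ‖(RCLike.I : 𝕜)‖ ≤ 1 := by
    rw [RCLike.norm_I]
    split_ifs <;> norm_num
  have hsub : {ψ : UnitHarmonic 𝕜 m N | t < ‖(ψ : SphericalHarmonic 𝕜 m N) x‖} ⊆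
      (s 1 ∪ s (-1)) ∪ (s RCLike.I ∪ s (-RCLike.I)) := by
    intro ψ hψ
    have hψ : t < ‖(ψ : SphericalHarmonic 𝕜 m N) x‖ := hψ
    by_contra hcon
    simp only [Set.mem_union, not_or, s, Set.mem_ofPred_eq, not_le, one_mul, neg_mul, map_neg,
      RCLike.I_mul_re, neg_neg] at hcon
    have h1 : ‖(ψ : SphericalHarmonic 𝕜 m N) x‖ ≤
        |RCLike.re ((ψ : SphericalHarmonic 𝕜 m N) x)| +
          |RCLike.im ((ψ : SphericalHarmonic 𝕜 m N) x)| := by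
      refine abs_le_of_sq_le_sq' ?_ (by positivity) |>.2
      rw [← RCLike.normSq_eq_def', RCLike.normSq_apply]
      nlinarith [abs_mul_abs_self (RCLike.re ((ψ : SphericalHarmonic 𝕜 m N) x)),
        abs_mul_abs_self (RCLike.im ((ψ : SphericalHarmonic 𝕜 m N) x)),
        mul_nonneg (abs_nonneg (RCLike.re ((ψ : SphericalHarmonic 𝕜 m N) x)))
          (abs_nonneg (RCLike.im ((ψ : SphericalHarmonic 𝕜 m N) x)))]
    have h2 := abs_lt.2 ⟨neg_lt.1 hcon.1.2, hcon.1.1⟩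
    have h3 := abs_lt.2 ⟨neg_lt.1 hcon.2.1, hcon.2.2⟩
    linarith
  refine (measure_mono hsub).trans ((measure_union_le _ _).trans ?_)
  refine (add_le_add (measure_union_le _ _) (measure_union_le _ _)).trans ?_
  refine (add_le_add (add_le_add (hs (by simp)) (hs (by simp)))
    (add_le_add (hs hI) (hs (by simpa using hI)))).trans_eq ?_
  ring

/-! ### Tails of the sup norm -/

theorem supNorm_eq_norm (ψ : SphericalHarmonic 𝕜 m N) : ψ.supNorm = ‖ψ.toContinuousMap‖ :=
  (ContinuousMap.norm_eq_iSup_norm _).symm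

theorem supNorm_nonneg (ψ : SphericalHarmonic 𝕜 m N) : 0 ≤ ψ.supNorm :=
  ψ.supNorm_eq_norm ▸ norm_nonneg _

theorem norm_apply_le_supNorm (ψ : SphericalHarmonic 𝕜 m N) (x : UnitSphere m) :
    ‖ψ x‖ ≤ ψ.supNorm :=
  ψ.supNorm_eq_norm ▸ ψ.toContinuousMap.norm_coe_le_norm x

/-- If `|ψ| ≤ t` off a small set, then the sup norm of `ψ` is not much larger than `t`. The sup norm
of `ψ ^ p` is bounded through the space of homogeneous polynomials of degree `N p`, whose
dimension is at most `D`; the exceptional set contributes at most half of that bound. -/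
theorem supNorm_pow_le (ψ : SphericalHarmonic 𝕜 m N) (p : ℕ) {t D : ℝ} (ht : 0 ≤ t)
    (hD : ((N * p + 1 : ℕ) : ℝ) ^ (m + 1) ≤ D)
    (hA : (surfaceMeasure m).real {x | t < ‖ψ x‖} * (2 * D) ≤
      (surfaceMeasure m).real Set.univ) :
    ψ.supNorm ^ (2 * p) ≤ 2 * D * t ^ (2 * p) := by
  set σ := surfaceMeasure m
  set vol := σ.real Set.univ
  have hvol : 0 < vol := surfaceMeasure_real_univ_pos m
  set S := ψ.supNorm with hS
  have hS0 : 0 ≤ S := ψ.supNorm_nonneg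
  set A := {x | t < ‖ψ x‖} with hAdef
  have hD0 : 0 ≤ D := le_trans (by positivity) hD
  have hAm : MeasurableSet A := (isOpen_lt continuous_const ψ.continuous_coe.norm).measurableSet
  have : Nonempty (UnitSphere m) := ⟨⟨EuclideanSpace.single 0 1, by simp⟩⟩
  obtain ⟨x, -, hx⟩ := isCompact_univ.exists_isMaxOn Set.univ_nonempty
    ψ.continuous_coe.norm.continuousOn
  have hSx : S = ‖ψ x‖ :=
    le_antisymm (ciSup_le fun y => hx (Set.mem_univ y)) (ψ.norm_apply_le_supNorm x)
  have hker := norm_sq_mul_le_finrank_mul_integral (homogeneousOnSphere 𝕜 m (N * p))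
    (fun f hf R => comp_sphereMap_mem_homogeneousOnSphere 𝕜 hf R)
    (pow_mem_homogeneousOnSphere 𝕜 ψ.2 p) x
  have hval (y : UnitSphere m) : ‖(ψ.toContinuousMap ^ p) y‖ ^ 2 = ‖ψ y‖ ^ (2 * p) := by
    rw [ContinuousMap.pow_apply, norm_pow, ← pow_mul, mul_comm]
  change ‖(ψ.toContinuousMap ^ p) x‖ ^ 2 * _ ≤
    _ * ∫ y, ‖(ψ.toContinuousMap ^ p) y‖ ^ 2 ∂σ at hker
  simp only [hval, ← hSx] at hker
  have hdim : (Module.finrank 𝕜 (homogeneousOnSphere 𝕜 m (N * p)) : ℝ) ≤ D :=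
    le_trans (by exact_mod_cast finrank_homogeneousOnSphere_le 𝕜 m (N * p)) hD
  have hintA : Integrable (A.indicator fun _ => S ^ (2 * p)) σ :=
    (integrable_const _).indicator hAm
  have hint : ∫ y, ‖ψ y‖ ^ (2 * p) ∂σ ≤ t ^ (2 * p) * vol + S ^ (2 * p) * σ.real A := by
    have h1 : ∫ y, ‖ψ y‖ ^ (2 * p) ∂σ ≤
        ∫ y, (t ^ (2 * p) + A.indicator (fun _ => S ^ (2 * p)) y) ∂σ := by
      refine integral_mono ?_ ((integrable_const _).add hintA) fun y => ?_
      · exact (ψ.continuous_coe.norm.pow _).integrable_of_hasCompactSupport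
          (HasCompactSupport.of_compactSpace _)
      · by_cases hy : y ∈ A
        · simp only [Set.indicator_of_mem hy]
          have := pow_le_pow_left₀ (norm_nonneg _) (ψ.norm_apply_le_supNorm y) (2 * p)
          have ht' : 0 ≤ t ^ (2 * p) := by positivity
          linarith
        · simp only [Set.indicator_of_notMem hy, add_zero]
          exact pow_le_pow_left₀ (norm_nonneg _) (not_lt.1 hy) _
    refine h1.trans_eq ?_
    rw [integral_add (integrable_const _) hintA, integral_indicator_const _ hAm]
    simp only [integral_const, smul_eq_mul]
    ring
  have hSp : 0 ≤ S ^ (2 * p) := by positivity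
  have hfin : S ^ (2 * p) * vol ≤ D * (t ^ (2 * p) * vol + S ^ (2 * p) * σ.real A) := by
    refine hker.trans ((mul_le_mul_of_nonneg_left hint (by positivity)).trans ?_)
    gcongr
  refine le_of_mul_le_mul_right ?_ hvol
  nlinarith [mul_le_mul_of_nonneg_left hA hSp]

/-- On the finite-dimensional space `H_N` the sup norm is continuous for the `L²` norm. -/
theorem continuous_toContinuousMap :
    Continuous (toContinuousMap : SphericalHarmonic 𝕜 m N → C(UnitSphere m, 𝕜)) :=
  let L : SphericalHarmonic 𝕜 m N →ₗ[𝕜] C(UnitSphere m, 𝕜) := (sphericalHarmonics 𝕜 m N).subtype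
  L.continuous_of_finiteDimensional

theorem continuous_uncurry_apply :
    Continuous fun q : SphericalHarmonic 𝕜 m N × UnitSphere m => q.1 q.2 :=
  continuous_eval.comp (continuous_toContinuousMap.prodMap continuous_id)

/-- Markov's inequality for the size of the set where a random spherical harmonic exceeds `t`,
combined with `supNorm_pow_le`. -/
theorem uniformHarmonic_supNorm_gt_le (hm : 1 ≤ m) {p : ℕ} (hp : p ≠ 0) {t B D : ℝ} (ht : 0 ≤ t)
    (hB : 0 ≤ B) (hD : ((N * p + 1 : ℕ) : ℝ) ^ (m + 1) ≤ D) (hDB : 2 * D ≤ B ^ (2 * p)) :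
    (uniformHarmonic 𝕜 m N).real {ψ | B * t < (ψ : SphericalHarmonic 𝕜 m N).supNorm} ≤
      8 * D * Real.exp (-(3 / 32) * (surfaceMeasure m).real Set.univ * t ^ 2) := by
  have := isProbabilityMeasure_uniformHarmonic 𝕜 m N hm
  set σ := surfaceMeasure m
  set ν := uniformHarmonic 𝕜 m N
  have hvol : 0 < σ.real Set.univ := surfaceMeasure_real_univ_pos m
  have hD0 : 0 < D := lt_of_lt_of_le (by positivity) hD
  set q := Real.exp (-(3 / 32) * σ.real Set.univ * t ^ 2)
  let E : Set (UnitHarmonic 𝕜 m N × UnitSphere m) :=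
    {z | t < ‖(z.1 : SphericalHarmonic 𝕜 m N) z.2‖}
  have hE : MeasurableSet E := by
    have hc : Continuous fun z : UnitHarmonic 𝕜 m N × UnitSphere m =>
        (z.1 : SphericalHarmonic 𝕜 m N) z.2 :=
      continuous_uncurry_apply.comp (continuous_subtype_val.prodMap continuous_id)
    exact (isOpen_lt continuous_const hc.norm).measurableSet
  have hmean : ∫ ψ, σ.real (Prod.mk ψ ⁻¹' E) ∂ν ≤ 4 * q * σ.real Set.univ := by
    have h1 : (ν.prod σ) E ≤ 4 * ENNReal.ofReal q * σ Set.univ := by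
      rw [Measure.prod_apply_symm hE, ← lintegral_const]
      exact lintegral_mono fun x => uniformHarmonic_norm_apply_gt_le hm x ht
    have h2 : ∫ ψ, σ.real (Prod.mk ψ ⁻¹' E) ∂ν = ((ν.prod σ) E).toReal := by
      rw [Measure.prod_apply hE]
      exact integral_toReal (measurable_measure_prodMk_left hE).aemeasurable
        (ae_of_all _ fun ψ => measure_lt_top _ _)
    rw [h2]
    refine (ENNReal.toReal_mono ?_ h1).trans_eq ?_
    · finiteness
    · simp [ENNReal.toReal_mul, Measure.real, ENNReal.toReal_ofReal (Real.exp_pos _).le, q]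
  have hsub : {ψ : UnitHarmonic 𝕜 m N | B * t < (ψ : SphericalHarmonic 𝕜 m N).supNorm} ⊆
      {ψ | σ.real Set.univ / (2 * D) ≤ σ.real (Prod.mk ψ ⁻¹' E)} := by
    intro ψ hψ
    have hψ : B * t < (ψ : SphericalHarmonic 𝕜 m N).supNorm := hψ
    by_contra hcon
    have hcon : σ.real (Prod.mk ψ ⁻¹' E) < σ.real Set.univ / (2 * D) := not_le.1 hcon
    rw [lt_div_iff₀ (by positivity)] at hcon
    have h := supNorm_pow_le (ψ : SphericalHarmonic 𝕜 m N) p ht hD hcon.le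
    have h' : (ψ : SphericalHarmonic 𝕜 m N).supNorm ^ (2 * p) ≤ (B * t) ^ (2 * p) := by
      rw [mul_pow]
      exact h.trans (by gcongr)
    exact absurd (pow_lt_pow_left₀ hψ (by positivity) (by omega)) (not_lt.2 h')
  have hmarkov := mul_meas_ge_le_integral_of_nonneg (μ := ν)
    (f := fun ψ => σ.real (Prod.mk ψ ⁻¹' E)) (ae_of_all _ fun ψ => measureReal_nonneg)
    (by
      refine Integrable.of_bound
        (measurable_measure_prodMk_left hE).ennreal_toReal.aestronglyMeasurable
        (σ.real Set.univ) (ae_of_all _ fun ψ => ?_)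
      rw [Real.norm_of_nonneg measureReal_nonneg]
      exact measureReal_mono (Set.subset_univ _)) (σ.real Set.univ / (2 * D))
  have hle := measureReal_mono hsub (measure_ne_top ν _)
  have h3 : σ.real Set.univ / (2 * D) *
      ν.real {ψ | B * t < (ψ : SphericalHarmonic 𝕜 m N).supNorm} ≤ 4 * q * σ.real Set.univ :=
    (mul_le_mul_of_nonneg_left hle (by positivity)).trans (hmarkov.trans hmean)
  rw [div_mul_eq_mul_div, div_le_iff₀ (by positivity)] at h3
  refine le_of_mul_le_mul_left ?_ hvol
  linarith

/-- The sup norm exceeds `C √(log N)` with probability at most `8 N ^ (-k)`, as soon as `C` is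
large. In `uniformHarmonic_supNorm_gt_le`, `D` is the power `N ^ (3 (m + 1))` and `p = ⌈log N⌉`, so
that `(2 D) ^ (1 / (2 p))` stays bounded. -/
theorem exists_forall_uniformHarmonic_supNorm_gt_le (𝕜 : Type*) [RCLike 𝕜] (m : ℕ) (hm : 1 ≤ m)
    (k : ℝ) : ∃ C₀ : ℝ, 0 < C₀ ∧ ∀ C : ℝ, C₀ ≤ C → ∀ N : ℕ, 3 ≤ N →
      (uniformHarmonic 𝕜 m N).real
          {ψ | C * Real.sqrt (Real.log N) < (ψ : SphericalHarmonic 𝕜 m N).supNorm} ≤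
        8 * (N : ℝ) ^ (-k) := by
  have hvol : 0 < (surfaceMeasure m).real Set.univ := surfaceMeasure_real_univ_pos m
  set a : ℝ := 3 * (m + 1) with ha
  -- `B ^ (2 p) = exp ((a + 1) p) ≥ N ^ (a + 1) ≥ 2 N ^ a` for `p ≥ log N`.
  set B : ℝ := Real.exp ((a + 1) / 2) with hB
  have hB0 : 0 < B := Real.exp_pos _
  set c : ℝ := 3 / 32 * (surfaceMeasure m).real Set.univ / B ^ 2 with hc
  have hc0 : 0 < c := by positivity
  refine ⟨Real.sqrt ((|k| + a) / c), Real.sqrt_pos.2 (by positivity), fun C hC N hN => ?_⟩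
  have hC0 : 0 ≤ C := (Real.sqrt_nonneg _).trans hC
  have hcC : k + a ≤ c * C ^ 2 := by
    have h1 : (|k| + a) / c ≤ C ^ 2 := (Real.sqrt_le_left hC0).1 hC
    rw [div_le_iff₀ hc0] at h1
    linarith [le_abs_self k]
  have hN0 : (0 : ℝ) < N := by positivity
  have hN3 : (3 : ℝ) ≤ N := by exact_mod_cast hN
  have hlog : 1 < Real.log N := by
    rw [Real.lt_log_iff_exp_lt hN0]
    exact Real.exp_one_lt_d9.trans_le (by linarith)
  set p : ℕ := ⌈Real.log N⌉₊ with hp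
  have hlp : Real.log N ≤ p := Nat.le_ceil _
  have hp0 : p ≠ 0 := by
    rintro h
    rw [h] at hlp
    norm_num at hlp
    linarith
  have hpN : p ≤ N := Nat.ceil_le.2 ((Real.log_le_sub_one_of_pos hN0).trans (by linarith))
  have hexp (b : ℝ) : (N : ℝ) ^ b = Real.exp (Real.log N * b) := Real.rpow_def_of_pos hN0 b
  have hD : ((N * p + 1 : ℕ) : ℝ) ^ (m + 1) ≤ (N : ℝ) ^ a := by
    have h1 : N * p + 1 ≤ N ^ 3 := by nlinarith [Nat.mul_le_mul_left N hpN]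
    calc ((N * p + 1 : ℕ) : ℝ) ^ (m + 1) ≤ ((N : ℝ) ^ 3) ^ (m + 1) := by
          gcongr; exact_mod_cast h1
      _ = (N : ℝ) ^ a := by
          rw [← pow_mul, ← Real.rpow_natCast, ha]
          push_cast; rfl
  have hDB : 2 * (N : ℝ) ^ a ≤ B ^ (2 * p) := by
    calc 2 * (N : ℝ) ^ a ≤ N * (N : ℝ) ^ a := by gcongr; linarith
      _ = Real.exp ((a + 1) * Real.log N) := by
          rw [← Real.rpow_one_add' hN0.le (by positivity), hexp]; congr 1; ring
      _ ≤ Real.exp ((a + 1) * p) := by gcongr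
      _ = B ^ (2 * p) := by rw [hB, ← Real.exp_nat_mul]; congr 1; push_cast; ring
  have h := uniformHarmonic_supNorm_gt_le (𝕜 := 𝕜) hm hp0
    (t := C / B * Real.sqrt (Real.log N)) (by positivity) hB0.le hD hDB
  have e1 : B * (C / B * Real.sqrt (Real.log N)) = C * Real.sqrt (Real.log N) := by field_simp
  rw [e1] at h
  refine h.trans ?_
  rw [mul_assoc]
  refine mul_le_mul_of_nonneg_left ?_ (by norm_num)
  rw [hexp, hexp, ← Real.exp_add, Real.exp_le_exp, mul_pow, Real.sq_sqrt (by linarith)]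
  have e2 : -(3 / 32) * (surfaceMeasure m).real Set.univ * ((C / B) ^ 2 * Real.log N) =
      -(Real.log N * (c * C ^ 2)) := by rw [hc]; field_simp
  rw [e2]
  nlinarith [mul_le_mul_of_nonneg_left hcC (by linarith : (0 : ℝ) ≤ Real.log N)]

end SphericalHarmonic

/-! ### Random sequences -/

/-- The Borel–Cantelli lemma for the coordinates of a random sequence. -/
theorem ae_eventually_supNorm_le {𝕜 : Type*} [RCLike 𝕜] {m : ℕ} (hm : 1 ≤ m) {C K : ℝ}
    (hC : ∀ N : ℕ, 3 ≤ N → (uniformHarmonic 𝕜 m N).real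
      {ψ | C * Real.sqrt (Real.log N) < (ψ : SphericalHarmonic 𝕜 m N).supNorm} ≤
        K * (N : ℝ) ^ (-2 : ℝ)) :
    ∀ᵐ ψ ∂(uniformHarmonicSeq 𝕜 m), ∀ᶠ N : ℕ+ in atTop,
      (ψ N : SphericalHarmonic 𝕜 m N).supNorm ≤ C * Real.sqrt (Real.log N) := by
  have hprob (N : ℕ+) := isProbabilityMeasure_uniformHarmonic 𝕜 m N hm
  have hbad (N : ℕ) : MeasurableSet {ψ : UnitHarmonic 𝕜 m N |
      C * Real.sqrt (Real.log N) < (ψ : SphericalHarmonic 𝕜 m N).supNorm} := by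
    have hc : Continuous fun ψ : UnitHarmonic 𝕜 m N =>
        (ψ : SphericalHarmonic 𝕜 m N).supNorm := by
      simp only [SphericalHarmonic.supNorm_eq_norm]
      exact (SphericalHarmonic.continuous_toContinuousMap.comp continuous_subtype_val).norm
    exact (isOpen_lt continuous_const hc).measurableSet
  let s (N : ℕ+) : Set (∀ N : ℕ+, UnitHarmonic 𝕜 m N) :=
    {ψ | C * Real.sqrt (Real.log N) < (ψ N : SphericalHarmonic 𝕜 m N).supNorm}
  have hs (N : ℕ+) : uniformHarmonicSeq 𝕜 m (s N) = uniformHarmonic 𝕜 m N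
      {ψ | C * Real.sqrt (Real.log N) < (ψ : SphericalHarmonic 𝕜 m N).supNorm} :=
    (measurePreserving_eval_infinitePi
      (fun N : ℕ+ => uniformHarmonic 𝕜 m N) N).measure_preimage (hbad N).nullMeasurableSet
  have hsum : ∑' N, uniformHarmonicSeq 𝕜 m (s N) ≠ ⊤ := by
    have hS : Summable fun N : ℕ+ => (uniformHarmonic 𝕜 m N).real
        {ψ | C * Real.sqrt (Real.log N) < (ψ : SphericalHarmonic 𝕜 m N).supNorm} := by
      have h2 : Summable fun N : ℕ+ => K * ((N : ℕ) : ℝ) ^ (-2 : ℝ) :=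
        ((Real.summable_nat_rpow.2 (by norm_num)).comp_injective PNat.coe_injective).mul_left K
      refine h2.of_norm_bounded_eventually ?_
      refine (Set.finite_Iio (3 : ℕ+)).subset fun N hN => ?_
      by_contra h
      refine hN ?_
      change ‖_‖ ≤ _
      rw [Real.norm_of_nonneg measureReal_nonneg]
      exact hC N (by exact_mod_cast not_lt.1 h)
    have := hS.tsum_ofReal_ne_top
    convert this using 3 with N
    rw [hs, ofReal_measureReal]
  filter_upwards [ae_finite_setOfPred_mem hsum] with ψ hψ
  obtain ⟨M, hM⟩ := hψ.bddAbove
  filter_upwards [eventually_gt_atTop M] with N hN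
  by_contra h
  exact absurd (hM (show N ∈ {i | ψ ∈ s i} from not_le.1 h)) (not_le.2 hN)

theorem mainTheorem1 (𝕜 : Type*) [RCLike 𝕜] (m : ℕ) (hm : 1 ≤ m) :
    (∃ C : ℝ, 0 < C ∧
      (fun N : ℕ => (uniformHarmonic 𝕜 m N).real
          {ψ | C * Real.sqrt (Real.log N) < (ψ : SphericalHarmonic 𝕜 m N).supNorm})
        =O[atTop] (fun N : ℕ => 1 / (N : ℝ) ^ 2) ∧
      ∀ᵐ ψ ∂(uniformHarmonicSeq 𝕜 m),
        limsup (fun N : ℕ+ => (((ψ N : SphericalHarmonic 𝕜 m N).supNorm /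
          Real.sqrt (Real.log N) : ℝ) : EReal)) atTop ≤ (C : EReal)) ∧
    (∀ k : ℝ, 0 < k → ∃ C₀ : ℝ, 0 < C₀ ∧ ∀ C : ℝ, C₀ ≤ C →
      (fun N : ℕ => (uniformHarmonic 𝕜 m N).real
          {ψ | C * Real.sqrt (Real.log N) < (ψ : SphericalHarmonic 𝕜 m N).supNorm})
        =O[atTop] (fun N : ℕ => (N : ℝ) ^ (-k))) ∧
    (∀ᵐ ψ ∂(uniformHarmonicSeq 𝕜 m),
      (fun N : ℕ+ => (ψ N : SphericalHarmonic 𝕜 m N).supNorm)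
        =O[atTop] (fun N : ℕ+ => Real.sqrt (Real.log N))) := by
  have hO (k C : ℝ) (h : ∀ N : ℕ, 3 ≤ N → (uniformHarmonic 𝕜 m N).real
      {ψ | C * Real.sqrt (Real.log N) < (ψ : SphericalHarmonic 𝕜 m N).supNorm} ≤
        8 * (N : ℝ) ^ (-k)) :
      (fun N : ℕ => (uniformHarmonic 𝕜 m N).real
          {ψ | C * Real.sqrt (Real.log N) < (ψ : SphericalHarmonic 𝕜 m N).supNorm})
        =O[atTop] (fun N : ℕ => (N : ℝ) ^ (-k)) := by
    refine IsBigO.of_bound 8 ?_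
    filter_upwards [eventually_ge_atTop 3] with N hN
    rw [Real.norm_of_nonneg measureReal_nonneg, Real.norm_of_nonneg (by positivity)]
    exact h N hN
  obtain ⟨C, hC0, hC⟩ :=
    SphericalHarmonic.exists_forall_uniformHarmonic_supNorm_gt_le 𝕜 m hm 2
  have hae := ae_eventually_supNorm_le hm (hC C le_rfl)
  refine ⟨⟨C, hC0, ?_, ?_⟩, ?_, ?_⟩
  · refine (hO 2 C (hC C le_rfl)).congr_right fun N => ?_
    rw [Real.rpow_neg (by positivity), one_div]
    norm_cast
  · filter_upwards [hae] with ψ hψ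
    refine limsup_le_of_le (by isBoundedDefault) ?_
    filter_upwards [hψ] with N hN
    rw [EReal.coe_le_coe_iff]
    exact div_le_of_le_mul₀ (Real.sqrt_nonneg _) hC0.le hN
  · intro k _
    obtain ⟨C₀, h0, h⟩ :=
      SphericalHarmonic.exists_forall_uniformHarmonic_supNorm_gt_le 𝕜 m hm k
    exact ⟨C₀, h0, fun C hCC => hO k C (h C hCC)⟩
  · filter_upwards [hae] with ψ hψ
    refine IsBigO.of_bound C ?_
    filter_upwards [hψ] with N hN
    rwa [Real.norm_of_nonneg (SphericalHarmonic.supNorm_nonneg _),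
      Real.norm_of_nonneg (Real.sqrt_nonneg _)]
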